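/- An \emph{idempotent semifield} is a commutative semiring $(F,+,\times,0,1)$ with $0\neq 1$ in which every nonzero element has a multiplicative inverse and $x+x=x$ for all $x$; morphisms are semiring homomorphisms (preserving $+,\times,0,1$). An \emph{abelian $\ell$-group} is an abelian group with a translation-invariant lattice order; morphisms are the maps that are both group and lattice homomorphisms. An \emph{MV-algebra} is a structure $(A,\oplus,0,1,\neg)$ such that $(A,\oplus,0)$ is a commutative monoid, $\neg 0=1$, $x\oplus 1=1$, $\neg\neg x=x$ and $\neg(\neg x\oplus y)\oplus y=\neg(\neg y\oplus x)\oplus x$; morphisms preserve $\oplus,0,1,\neg$. Put $x\le y$ iff $y=x\oplus z$ for some $z$; an element $x$ is \emph{infinitesimal} if $nx=x\oplus\dots\oplus x\le\neg x$ for every integer $n\ge 1$, and the set of infinitesimals is the \emph{radical}. An MV-algebra is \emph{perfect} if $0\ne 1$ and it is generated, as an MV-algebra, by its radical; perfect MV-algebras form a full subcategory of the category of MV-algebras. Let $\rho$ be the functor from idempotent semifields to abelian $\ell$-groups sending $F$ to the multiplicative group $F\setminus\{0\}$ ordered by $x\le y\iff x+y=y$, and a homomorphism to its restriction. For an abelian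 $\ell$-group $H$ with a strong unit $u$ (i.e. $u\ge 0$ and for every $h\in H$ there is $n\ge1$ with $h\le nu$), let $\Gamma(H,u)$ be the MV-algebra on the interval $[0,u]$ with $x\oplus y=(x+y)\wedge u$, $\neg x=u-x$, zero $0$ and one $u$. Let $\Delta$ be the functor from abelian $\ell$-groups to perfect MV-algebras given by $\Delta(G)=\Gamma(\mathbb Z\times_{\mathrm{lex}}G,(1,0))$, where $\mathbb Z\times_{\mathrm{lex}}G$ is the product group with the lexicographic order ($\mathbb Z$-coordinate first), acting on a morphism $f$ by $(n,g)\mapsto(n,f(g))$. \textbf{Theorem.} The functors $\rho$ and $\Delta$ are equivalences of categories; consequently the composite $\Delta\circ\rho$ is an equivalence from the category of idempotent semifields to the category of perfect MV-algebras. -/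

import Mathlib

universe u

open CategoryTheory

/-! ### Idempotent semifields -/

/-- An idempotent semifield: a commutative semiring with `0 ≠ 1` in which every nonzero element is
invertible and `x + x = x` for all `x`. -/
structure IdemSemifield : Type (u + 1) where
  carrier : Type u
  [semifield : Semifield carrier]
  add_self : ∀ x : carrier, x + x = x

namespace IdemSemifield

attribute [instance] IdemSemifield.semifield

/-- Morphisms are the semiring homomorphisms (preserving `+`, `*`, `0`, `1`). -/
@[ext]
structure Hom (F K : IdemSemifield.{u}) where
  toRingHom : F.carrier →+* K.carrier

instance : Category IdemSemifield.{u} where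
  Hom F K := Hom F K
  id F := ⟨RingHom.id F.carrier⟩
  comp f g := ⟨g.toRingHom.comp f.toRingHom⟩

end IdemSemifield

/-! ### Abelian lattice-ordered groups -/

/-- An abelian ℓ-group, written additively. -/
structure AbLGroup : Type (u + 1) where
  carrier : Type u
  [addCommGroup : AddCommGroup carrier]
  [lattice : Lattice carrier]
  [isOrdered : IsOrderedAddMonoid carrier]

namespace AbLGroup

attribute [instance] AbLGroup.addCommGroup AbLGroup.lattice AbLGroup.isOrdered

/-- Homomorphisms of ℓ-groups: maps that are group and lattice homomorphisms. -/
@[ext]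
structure Hom (G H : AbLGroup.{u}) where
  toFun : G.carrier → H.carrier
  map_add : ∀ x y, toFun (x + y) = toFun x + toFun y
  map_sup : ∀ x y, toFun (x ⊔ y) = toFun x ⊔ toFun y
  map_inf : ∀ x y, toFun (x ⊓ y) = toFun x ⊓ toFun y

/-- An ℓ-group homomorphism as a homomorphism of additive groups. -/
def Hom.toAddMonoidHom {G H : AbLGroup.{u}} (f : Hom G H) : G.carrier →+ H.carrier :=
  AddMonoidHom.mk' f.toFun f.map_add

theorem Hom.map_zero {G H : AbLGroup.{u}} (f : Hom G H) : f.toFun 0 = 0 :=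
  f.toAddMonoidHom.map_zero

theorem Hom.map_sub {G H : AbLGroup.{u}} (f : Hom G H) (x y : G.carrier) :
    f.toFun (x - y) = f.toFun x - f.toFun y :=
  f.toAddMonoidHom.map_sub x y

theorem Hom.monotone {G H : AbLGroup.{u}} (f : Hom G H) {x y : G.carrier} (h : x ≤ y) :
    f.toFun x ≤ f.toFun y := by
  rw [← sup_eq_right, ← f.map_sup, sup_eq_right.2 h]

instance : Category AbLGroup.{u} where
  Hom G H := Hom G H
  id G := ⟨id, fun _ _ => rfl, fun _ _ => rfl, fun _ _ => rfl⟩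
  comp f g := ⟨g.toFun ∘ f.toFun,
    fun x y => by simp [f.map_add, g.map_add],
    fun x y => by simp [f.map_sup, g.map_sup],
    fun x y => by simp [f.map_inf, g.map_inf]⟩

end AbLGroup

/-- An abelian ℓ-group with a distinguished strong unit. -/
structure UnitalAbLGroup : Type (u + 1) where
  group : AbLGroup.{u}
  unit : group.carrier
  unit_nonneg : 0 ≤ unit
  unit_strong : ∀ g : group.carrier, ∃ n : ℕ, 1 ≤ n ∧ g ≤ n • unit

namespace UnitalAbLGroup

/-- Unital ℓ-group homomorphisms: ℓ-group homomorphisms preserving the distinguished unit. -/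
@[ext]
structure Hom (G H : UnitalAbLGroup.{u}) where
  toHom : AbLGroup.Hom G.group H.group
  map_unit : toHom.toFun G.unit = H.unit

instance : Category UnitalAbLGroup.{u} where
  Hom G H := Hom G H
  id G := ⟨𝟙 G.group, rfl⟩
  comp {G H K} f g := ⟨CategoryStruct.comp (X := G.group) (Y := H.group) (Z := K.group)
    f.toHom g.toHom, (congrArg g.toHom.toFun f.map_unit).trans g.map_unit⟩

end UnitalAbLGroup

/-! ### MV-algebras -/

/-- MV-algebras `(A, ⊕, 0, 1, ¬)`. -/
class MVAlgebra (A : Type u) where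
  oplus : A → A → A
  zero : A
  one : A
  neg : A → A
  oplus_assoc : ∀ x y z, oplus (oplus x y) z = oplus x (oplus y z)
  oplus_comm : ∀ x y, oplus x y = oplus y x
  oplus_zero : ∀ x, oplus x zero = x
  neg_zero : neg zero = one
  oplus_one : ∀ x, oplus x one = one
  neg_neg : ∀ x, neg (neg x) = x
  lukasiewicz : ∀ x y, oplus (neg (oplus (neg x) y)) y = oplus (neg (oplus (neg y) x)) x

namespace MVAlgebra

variable {A : Type u} [MVAlgebra A]

/-- The natural order: `x ≤ y` iff `y = x ⊕ z` for some `z`. -/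
def le (x y : A) : Prop := ∃ z, y = oplus x z

/-- The `n`-fold sum `n x = x ⊕ ⋯ ⊕ x`. -/
def nmul : ℕ → A → A
  | 0, _ => zero
  | n + 1, x => oplus (nmul n x) x

/-- `x` is infinitesimal if `n x ≤ ¬ x` for every positive integer `n`. -/
def IsInfinitesimal (x : A) : Prop := ∀ n : ℕ, 1 ≤ n → le (nmul n x) (neg x)

variable (A) in
/-- The radical: the set of all infinitesimals. -/
def rad : Set A := {x | IsInfinitesimal x}

/-- Membership in the MV-subalgebra generated by a set `S`. -/
inductive Generated (S : Set A) : A → Prop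
  | of {x : A} : x ∈ S → Generated S x
  | zero : Generated S zero
  | one : Generated S one
  | oplus {x y : A} : Generated S x → Generated S y → Generated S (oplus x y)
  | neg {x : A} : Generated S x → Generated S (neg x)

variable (A) in
/-- A perfect MV-algebra is a nontrivial MV-algebra generated by its radical. -/
def IsPerfect : Prop := (zero : A) ≠ one ∧ ∀ x : A, Generated (rad A) x

end MVAlgebra

/-- Bundled MV-algebras. -/
structure MVAlg : Type (u + 1) where
  carrier : Type u
  [mvAlgebra : MVAlgebra carrier]

namespace MVAlg

attribute [instance] MVAlg.mvAlgebra

/-- Homomorphisms of MV-algebras. -/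
@[ext]
structure Hom (A B : MVAlg.{u}) where
  toFun : A.carrier → B.carrier
  map_oplus : ∀ x y, toFun (MVAlgebra.oplus x y) = MVAlgebra.oplus (toFun x) (toFun y)
  map_zero : toFun MVAlgebra.zero = MVAlgebra.zero
  map_one : toFun MVAlgebra.one = MVAlgebra.one
  map_neg : ∀ x, toFun (MVAlgebra.neg x) = MVAlgebra.neg (toFun x)

instance : Category MVAlg.{u} where
  Hom A B := Hom A B
  id A := ⟨id, fun _ _ => rfl, rfl, rfl, fun _ => rfl⟩
  comp f g := ⟨g.toFun ∘ f.toFun,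
    fun x y => by simp [f.map_oplus, g.map_oplus],
    by simp [f.map_zero, g.map_zero],
    by simp [f.map_one, g.map_one],
    fun x => by simp [f.map_neg, g.map_neg]⟩

/-- The property of being a perfect MV-algebra. -/
def perfect : ObjectProperty MVAlg.{u} := fun A => MVAlgebra.IsPerfect A.carrier

end MVAlg

/-- The category of perfect MV-algebras: the full subcategory of MV-algebras on the perfect ones. -/
abbrev PerfectMVAlg : Type (u + 1) := MVAlg.perfect.{u}.FullSubcategory

/-! ### The functor `ρ` -/

namespace IdemSemifield

variable (F : IdemSemifield.{u})

theorem add_ne_zero {x y : F.carrier} (hx : x ≠ 0) : x + y ≠ 0 := by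
  intro h
  apply hx
  calc x = x + (x + y) := by rw [h, add_zero]
    _ = x + y := by rw [← add_assoc, F.add_self]
    _ = 0 := h

/-- The sum of two nonzero elements, as a nonzero element. -/
def unitsAdd (a b : (F.carrier)ˣ) : (F.carrier)ˣ :=
  Units.mk0 ((a : F.carrier) + b) (F.add_ne_zero a.ne_zero)

theorem val_unitsAdd (a b : (F.carrier)ˣ) :
    ((F.unitsAdd a b : (F.carrier)ˣ) : F.carrier) = (a : F.carrier) + b := rfl

theorem inv_add_inv_iff (a b : (F.carrier)ˣ) :
    ((b⁻¹ : (F.carrier)ˣ) : F.carrier) + (a⁻¹ : (F.carrier)ˣ) = (a⁻¹ : (F.carrier)ˣ) ↔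
      (a : F.carrier) + b = b := by
  have ha := a.ne_zero
  have hb := b.ne_zero
  rw [Units.val_inv_eq_inv_val, Units.val_inv_eq_inv_val]
  constructor
  · intro h
    have := congrArg (fun t => (a : F.carrier) * b * t) h
    simp only [mul_add] at this
    rwa [mul_inv_cancel_right₀ hb, mul_comm (a : F.carrier) b, mul_inv_cancel_right₀ ha] at this
  · intro h
    have := congrArg (fun t => (a : F.carrier)⁻¹ * (b : F.carrier)⁻¹ * t) h
    simp only [mul_add] at this
    rwa [inv_mul_cancel_right₀ hb, mul_comm (a : F.carrier)⁻¹, inv_mul_cancel_right₀ ha] at this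

/-- The lattice structure on the group `F ∖ {0}` (realised as the units of `F`, written
additively): `x ≤ y` iff `x + y = y` in `F`; the join is the sum of `F`, and the meet
is `(x⁻¹ + y⁻¹)⁻¹`. -/
@[reducible]
def unitsLattice : Lattice (Additive (F.carrier)ˣ) where
  le a b := (a.toMul : F.carrier) + (b.toMul : F.carrier) = (b.toMul : F.carrier)
  le_refl a := F.add_self _
  le_trans a b c hab hbc := by rw [← hbc, ← add_assoc, hab]
  le_antisymm a b hab hba := by
    apply Additive.toMul.injective
    apply Units.ext
    rw [← hba, add_comm, hab]
  sup a b := Additive.ofMul (F.unitsAdd a.toMul b.toMul)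
  le_sup_left a b := by
    change _ + (_ + _) = (_ + _)
    rw [← add_assoc, F.add_self]
  le_sup_right a b := by
    change _ + (_ + _) = (_ + _)
    rw [add_left_comm, F.add_self]
  sup_le a b c hac hbc := by
    change (_ + _) + _ = _
    rw [add_assoc, hbc, hac]
  inf a b := Additive.ofMul (F.unitsAdd (a.toMul)⁻¹ (b.toMul)⁻¹)⁻¹
  inf_le_left a b := by
    rw [← F.inv_add_inv_iff, toMul_ofMul, inv_inv, val_unitsAdd, ← add_assoc, F.add_self]
  inf_le_right a b := by
    rw [← F.inv_add_inv_iff, toMul_ofMul, inv_inv, val_unitsAdd, add_left_comm, F.add_self]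
  le_inf a b c hab hac := by
    rw [← F.inv_add_inv_iff] at hab hac ⊢
    rw [toMul_ofMul, inv_inv, val_unitsAdd, add_assoc, hac, hab]

/-- The abelian ℓ-group `(F ∖ {0}, ·, 1)`, written additively. -/
def rhoObj : AbLGroup.{u} :=
  letI := F.unitsLattice
  { carrier := Additive (F.carrier)ˣ
    isOrdered :=
      { add_le_add_left := fun a b hab c => by
          change ((a.toMul * c.toMul : (F.carrier)ˣ) : F.carrier) +
            ((b.toMul * c.toMul : (F.carrier)ˣ) : F.carrier) = (b.toMul * c.toMul : (F.carrier)ˣ)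
          have h : (a.toMul : F.carrier) + (b.toMul : F.carrier) = (b.toMul : F.carrier) := hab
          rw [Units.val_mul, Units.val_mul, ← add_mul, h] } }

variable {F} {K : IdemSemifield.{u}}

/-- The restriction of a semiring homomorphism to the nonzero elements. -/
def rhoMap (f : F.carrier →+* K.carrier) (a : Additive (F.carrier)ˣ) : Additive (K.carrier)ˣ :=
  Additive.ofMul (Units.map (f : F.carrier →* K.carrier) a.toMul)

theorem rhoMap_add (f : F.carrier →+* K.carrier) (a b : Additive (F.carrier)ˣ) :
    rhoMap f (a + b) = rhoMap f a + rhoMap f b :=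
  congrArg Additive.ofMul (map_mul (Units.map (f : F.carrier →* K.carrier)) a.toMul b.toMul)

theorem map_unitsAdd (f : F.carrier →+* K.carrier) (a b : (F.carrier)ˣ) :
    Units.map (f : F.carrier →* K.carrier) (F.unitsAdd a b) =
      K.unitsAdd (Units.map (f : F.carrier →* K.carrier) a)
        (Units.map (f : F.carrier →* K.carrier) b) :=
  Units.ext (map_add f (a : F.carrier) (b : F.carrier))

theorem rhoMap_sup (f : F.carrier →+* K.carrier) (a b : Additive (F.carrier)ˣ) :
    rhoMap f (F.unitsLattice.sup a b) = K.unitsLattice.sup (rhoMap f a) (rhoMap f b) :=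
  congrArg Additive.ofMul (map_unitsAdd f a.toMul b.toMul)

theorem rhoMap_inf (f : F.carrier →+* K.carrier) (a b : Additive (F.carrier)ˣ) :
    rhoMap f (F.unitsLattice.inf a b) = K.unitsLattice.inf (rhoMap f a) (rhoMap f b) := by
  refine congrArg Additive.ofMul ?_
  change Units.map (f : F.carrier →* K.carrier) (F.unitsAdd (a.toMul)⁻¹ (b.toMul)⁻¹)⁻¹ = _
  rw [map_inv, map_unitsAdd, map_inv, map_inv]
  rfl

end IdemSemifield

/-- Rump's functor `ρ`, sending an idempotent semifield `F` to the abelian ℓ-group `F ∖ {0}` and a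
homomorphism to its restriction. -/
def rho : IdemSemifield.{u} ⥤ AbLGroup.{u} where
  obj F := F.rhoObj
  map {F K} f :=
    { toFun := IdemSemifield.rhoMap f.toRingHom
      map_add := IdemSemifield.rhoMap_add f.toRingHom
      map_sup := IdemSemifield.rhoMap_sup f.toRingHom
      map_inf := IdemSemifield.rhoMap_inf f.toRingHom }

/-! ### Mundici's functor `Γ` -/

/-- The MV-algebra structure on the interval `[0, u]` of an abelian ℓ-group:
`x ⊕ y = (x + y) ⊓ u` and `¬ x = u - x`. -/
@[reducible]
def intervalMV {G : Type u} [AddCommGroup G] [Lattice G] [IsOrderedAddMonoid G] (u : G)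
    (hu : 0 ≤ u) : MVAlgebra (Set.Icc (0 : G) u) where
  oplus x y := ⟨(x.1 + y.1) ⊓ u, le_inf (add_nonneg x.2.1 y.2.1) hu, inf_le_right⟩
  zero := ⟨0, le_rfl, hu⟩
  one := ⟨u, hu, le_rfl⟩
  neg x := ⟨u - x.1, sub_nonneg.2 x.2.2, sub_le_self _ x.2.1⟩
  oplus_assoc x y z := Subtype.ext <| by
    have h1 : u ≤ u + z.1 := le_add_of_nonneg_right z.2.1
    have h2 : u ≤ x.1 + u := le_add_of_nonneg_left x.2.1
    change ((x.1 + y.1) ⊓ u + z.1) ⊓ u = (x.1 + (y.1 + z.1) ⊓ u) ⊓ u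
    rw [inf_add, add_inf, inf_assoc, inf_assoc, inf_eq_right.2 h1, inf_eq_right.2 h2, add_assoc]
  oplus_comm x y := Subtype.ext <| by
    change (x.1 + y.1) ⊓ u = (y.1 + x.1) ⊓ u
    rw [add_comm]
  oplus_zero x := Subtype.ext <| by
    change (x.1 + 0) ⊓ u = x.1
    rw [add_zero, inf_eq_left.2 x.2.2]
  neg_zero := Subtype.ext (sub_zero u)
  oplus_one x := Subtype.ext (inf_eq_right.2 (le_add_of_nonneg_left x.2.1))
  neg_neg x := Subtype.ext (sub_sub_cancel u x.1)
  lukasiewicz x y := Subtype.ext <| by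
    have key : ∀ a b : G, u - ((u - a + b) ⊓ u) + b = a ⊔ b := fun a b => by
      rw [sub_eq_add_neg, neg_inf, add_sup, sup_add]
      congr 1 <;> abel
    change (u - ((u - x.1 + y.1) ⊓ u) + y.1) ⊓ u = (u - ((u - y.1 + x.1) ⊓ u) + x.1) ⊓ u
    rw [key, key, sup_comm]

section interval

variable {G : Type u} [AddCommGroup G] [Lattice G] [IsOrderedAddMonoid G]

theorem intervalMV_le {u : G} (hu : 0 ≤ u) (x y : Set.Icc (0 : G) u) (h : x.1 ≤ y.1) :
    @MVAlgebra.le _ (intervalMV u hu) x y := by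
  refine ⟨⟨y.1 - x.1, sub_nonneg.2 h, (sub_le_self _ x.2.1).trans y.2.2⟩, Subtype.ext ?_⟩
  change y.1 = (x.1 + (y.1 - x.1)) ⊓ u
  rw [add_sub_cancel, inf_eq_left.2 y.2.2]

theorem intervalMV_nmul {u : G} (hu : 0 ≤ u) (x : Set.Icc (0 : G) u)
    (h : ∀ n : ℕ, n • x.1 ≤ u) (n : ℕ) :
    (@MVAlgebra.nmul _ (intervalMV u hu) n x).1 = n • x.1 := by
  induction n with
  | zero => exact (zero_nsmul _).symm
  | succ n ih =>
    change ((@MVAlgebra.nmul _ (intervalMV u hu) n x).1 + x.1) ⊓ u = _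
    rw [ih, ← succ_nsmul, inf_eq_left.2 (h _)]

theorem intervalMV_infinitesimal {u : G} (hu : 0 ≤ u) (x : Set.Icc (0 : G) u)
    (h : ∀ n : ℕ, n • x.1 ≤ u) : @MVAlgebra.IsInfinitesimal _ (intervalMV u hu) x := by
  intro n _
  apply intervalMV_le
  rw [intervalMV_nmul hu x h]
  change n • x.1 ≤ u - x.1
  rw [le_sub_iff_add_le, ← succ_nsmul]
  exact h _

end interval

/-- Mundici's functor `Γ`, sending `(G, u)` to the MV-algebra `[0, u]` and a unital ℓ-group
homomorphism to its restriction. -/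
def Gamma : UnitalAbLGroup.{u} ⥤ MVAlg.{u} where
  obj G := @MVAlg.mk (Set.Icc (0 : G.group.carrier) G.unit) (intervalMV G.unit G.unit_nonneg)
  map {G H} f :=
    { toFun := fun x : Set.Icc (0 : G.group.carrier) G.unit =>
        (⟨f.toHom.toFun x.1,
          (f.toHom.map_zero).symm.le.trans (f.toHom.monotone x.2.1),
          (f.toHom.monotone x.2.2).trans f.map_unit.le⟩ : Set.Icc (0 : H.group.carrier) H.unit)
      map_oplus := fun x y => Subtype.ext <|
        (f.toHom.map_inf _ _).trans (congrArg₂ (· ⊓ ·) (f.toHom.map_add _ _) f.map_unit)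
      map_zero := Subtype.ext f.toHom.map_zero
      map_one := Subtype.ext f.map_unit
      map_neg := fun x => Subtype.ext <|
        (f.toHom.map_sub _ _).trans (congrArg (· - _) f.map_unit) }

/-! ### The lexicographic product `ℤ ×ₗ G` and the functor `Δ` -/

/-- The lattice structure of the lexicographic order on `ℤ × G`. The order is Mathlib's
lexicographic order. -/
@[reducible]
noncomputable def lexLattice (G : Type u) [Lattice G] : Lattice (ℤ ×ₗ G) where
  __ := Prod.Lex.instPartialOrder ℤ G
  sup x y := if (ofLex x).1 < (ofLex y).1 then y else if (ofLex y).1 < (ofLex x).1 then x else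
    toLex ((ofLex x).1, (ofLex x).2 ⊔ (ofLex y).2)
  inf x y := if (ofLex x).1 < (ofLex y).1 then x else if (ofLex y).1 < (ofLex x).1 then y else
    toLex ((ofLex x).1, (ofLex x).2 ⊓ (ofLex y).2)
  le_sup_left x y := by
    split_ifs with h1 h2
    · exact Prod.Lex.le_iff.2 (Or.inl h1)
    · exact le_rfl
    · exact Prod.Lex.le_iff.2 (Or.inr ⟨rfl, le_sup_left⟩)
  le_sup_right x y := by
    split_ifs with h1 h2
    · exact le_rfl
    · exact Prod.Lex.le_iff.2 (Or.inl h2)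
    · exact Prod.Lex.le_iff.2 (Or.inr ⟨le_antisymm (not_lt.1 h1) (not_lt.1 h2), le_sup_right⟩)
  sup_le x y z hx hy := by
    split_ifs with h1 h2
    · exact hy
    · exact hx
    · rw [Prod.Lex.le_iff'] at hx hy ⊢
      have h : (ofLex x).1 = (ofLex y).1 := le_antisymm (not_lt.1 h2) (not_lt.1 h1)
      exact ⟨hx.1, fun e => sup_le (hx.2 e) (hy.2 (h.symm.trans e))⟩
  inf_le_left x y := by
    split_ifs with h1 h2
    · exact le_rfl
    · exact Prod.Lex.le_iff.2 (Or.inl h2)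
    · exact Prod.Lex.le_iff.2 (Or.inr ⟨rfl, inf_le_left⟩)
  inf_le_right x y := by
    split_ifs with h1 h2
    · exact Prod.Lex.le_iff.2 (Or.inl h1)
    · exact le_rfl
    · exact Prod.Lex.le_iff.2 (Or.inr ⟨le_antisymm (not_lt.1 h2) (not_lt.1 h1), inf_le_right⟩)
  le_inf x y z hy hz := by
    split_ifs with h1 h2
    · exact hy
    · exact hz
    · rw [Prod.Lex.le_iff'] at hy hz ⊢
      have h : (ofLex y).1 = (ofLex z).1 := le_antisymm (not_lt.1 h2) (not_lt.1 h1)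
      exact ⟨hy.1, fun e => le_inf (hy.2 e) (hz.2 (e.trans h))⟩

namespace AbLGroup

/-- The abelian ℓ-group `ℤ ×_lex G` with componentwise addition and lexicographic order. -/
noncomputable def lexZ (G : AbLGroup.{u}) : AbLGroup.{u} :=
  letI := lexLattice G.carrier
  { carrier := ℤ ×ₗ G.carrier
    isOrdered := Prod.Lex.isOrderedAddMonoid }

/-- The map `(n, g) ↦ (n, f g)` induced by an ℓ-group homomorphism `f`. -/
def lexZMap {G H : AbLGroup.{u}} (f : Hom G H) : Hom G.lexZ H.lexZ where
  toFun := fun x : ℤ ×ₗ G.carrier =>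
    (toLex ((ofLex x).1, f.toFun (ofLex x).2) : ℤ ×ₗ H.carrier)
  map_add x y := congrArg toLex (Prod.ext rfl (f.map_add _ _))
  map_sup x y := by
    refine (apply_ite (fun x : ℤ ×ₗ G.carrier =>
      (toLex ((ofLex x).1, f.toFun (ofLex x).2) : ℤ ×ₗ H.carrier)) _ _ _).trans ?_
    refine if_congr Iff.rfl rfl ?_
    refine (apply_ite (fun x : ℤ ×ₗ G.carrier =>
      (toLex ((ofLex x).1, f.toFun (ofLex x).2) : ℤ ×ₗ H.carrier)) _ _ _).trans ?_
    exact if_congr Iff.rfl rfl (congrArg toLex (Prod.ext rfl (f.map_sup _ _)))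
  map_inf x y := by
    refine (apply_ite (fun x : ℤ ×ₗ G.carrier =>
      (toLex ((ofLex x).1, f.toFun (ofLex x).2) : ℤ ×ₗ H.carrier)) _ _ _).trans ?_
    refine if_congr Iff.rfl rfl ?_
    refine (apply_ite (fun x : ℤ ×ₗ G.carrier =>
      (toLex ((ofLex x).1, f.toFun (ofLex x).2) : ℤ ×ₗ H.carrier)) _ _ _).trans ?_
    exact if_congr Iff.rfl rfl (congrArg toLex (Prod.ext rfl (f.map_inf _ _)))

end AbLGroup

/-- The functor `G ↦ (ℤ ×_lex G, (1, 0))`. -/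
noncomputable def lexZFunctor : AbLGroup.{u} ⥤ UnitalAbLGroup.{u} where
  obj G :=
    { group := G.lexZ
      unit := (toLex (1, 0) : ℤ ×ₗ G.carrier)
      unit_nonneg := by
        change (0 : ℤ ×ₗ G.carrier) ≤ toLex (1, 0)
        exact Prod.Lex.le_iff.2 (Or.inl one_pos)
      unit_strong := fun g => by
        change ∃ n : ℕ, 1 ≤ n ∧ (show ℤ ×ₗ G.carrier from g) ≤ n • toLex ((1 : ℤ), (0 : G.carrier))
        let g' : ℤ ×ₗ G.carrier := g
        refine ⟨(ofLex g').1.toNat + 1, by omega, Prod.Lex.le_iff.2 (Or.inl ?_)⟩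
        change (ofLex g').1 < (((ofLex g').1.toNat + 1) • ((1 : ℤ)))
        rw [nsmul_eq_mul]
        push_cast
        omega }
  map {G H} f :=
    { toHom := AbLGroup.lexZMap f
      map_unit := congrArg toLex (Prod.ext rfl f.map_zero) }

/-- The MV-algebra `Γ(ℤ ×_lex G, (1, 0))` is perfect. -/
theorem perfect_gamma_lexZ (G : AbLGroup.{u}) :
    MVAlg.perfect ((lexZFunctor ⋙ Gamma).obj G) := by
  let _ := lexLattice G.carrier
  have hu : (0 : ℤ ×ₗ G.carrier) ≤ toLex (1, 0) := Prod.Lex.le_iff.2 (Or.inl one_pos)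
  change @MVAlgebra.IsPerfect (Set.Icc (0 : ℤ ×ₗ G.carrier) (toLex (1, 0)))
    (intervalMV (toLex (1, 0)) hu)
  let _ := intervalMV (toLex ((1 : ℤ), (0 : G.carrier))) hu
  have hinf : ∀ x : Set.Icc (0 : ℤ ×ₗ G.carrier) (toLex (1, 0)), (ofLex x.1).1 = 0 →
      MVAlgebra.IsInfinitesimal x := fun x hx => by
    refine intervalMV_infinitesimal hu x fun n => Prod.Lex.le_iff.2 (Or.inl ?_)
    change n • (ofLex x.1).1 < 1
    rw [hx, smul_zero]
    exact one_pos
  refine ⟨fun h => ?_, fun x => ?_⟩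
  · have h1 : (0 : ℤ) = 1 := congrArg (fun x => (ofLex x.1).1) h
    exact zero_ne_one h1
  · have h0 : (0 : ℤ) ≤ (ofLex x.1).1 := (Prod.Lex.le_iff'.1 x.2.1).1
    have h1 : (ofLex x.1).1 ≤ (1 : ℤ) := (Prod.Lex.le_iff'.1 x.2.2).1
    rcases (by omega : (ofLex x.1).1 = 0 ∨ (ofLex x.1).1 = 1) with h | h
    · exact .of (hinf x h)
    · rw [← MVAlgebra.neg_neg x]
      refine .neg (.of (hinf _ ?_))
      change 1 - (ofLex x.1).1 = 0
      rw [h, sub_self]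

/-- The Di Nola–Lettieri functor `Δ(G) = Γ(ℤ ×_lex G, (1, 0))`. -/
noncomputable def Delta : AbLGroup.{u} ⥤ PerfectMVAlg.{u} :=
  MVAlg.perfect.lift (lexZFunctor ⋙ Gamma) perfect_gamma_lexZ

/-! For `ρ`, the inverse construction adjoins a least element `0` to an ℓ-group and takes the join
as addition. A semiring homomorphism is determined by its values on nonzero elements, and a
join-preserving group homomorphism extends by `0 ↦ 0`.

For `Δ`, the elements of `Δ(G)` are the infinitesimals `(0, g)` with `g ≥ 0` and their negations
`(1, -g)`. The radical is thus a copy of the positive cone of `G`, and an MV-homomorphism amounts to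
a map of positive cones preserving sums and truncated differences. Such a map extends uniquely to an
ℓ-group homomorphism (`exists_hom_of_nonneg`, `hom_ext_of_nonneg`).

For essential surjectivity, let `A` be perfect. Its radical is a cancellative lattice-ordered monoid
under `⊕`, and its group of differences is an ℓ-group whose positive cone is the radical itself
(`exists_ofRad_of_nonneg`). Every element of `A` is an infinitesimal or the negation of one, never
both (`mem_rad_or_neg_mem_rad`, `neg_notMem_rad`), so `A` is recovered from this ℓ-group.

The delicate point is that infinitesimals are closed under `⊕`. Prelinearity, `(x ⊖ y) ⊓ (y ⊖ x) =
0`, lets one argue as if `x` and `y` were comparable. Hence doubling preserves joins, the radical is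
closed under joins, and `x ⊕ y ≤ 2(x ⊔ y)` finishes. -/

/-! ### Isomorphisms of ℓ-groups -/

namespace AbLGroup

/-- A group homomorphism between ℓ-groups that preserves joins preserves meets. -/
def Hom.ofSup {G H : AbLGroup.{u}} (f : G.carrier →+ H.carrier)
    (hf : ∀ x y, f (x ⊔ y) = f x ⊔ f y) : Hom G H where
  toFun := f
  map_add := f.map_add
  map_sup := hf
  map_inf x y := by
    rw [← neg_neg (x ⊓ y), neg_inf, f.map_neg, hf, f.map_neg, f.map_neg, ← neg_inf, neg_neg]

/-- A bijective homomorphism of ℓ-groups is an isomorphism. -/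
noncomputable def isoOfBijective {G H : AbLGroup.{u}} (f : Hom G H)
    (hf : Function.Bijective f.toFun) : G ≅ H where
  hom := f
  inv :=
    let e := Equiv.ofBijective f.toFun hf
    { toFun := e.symm
      map_add := fun x y => e.symm_apply_eq.2 <| by
        change x + y = f.toFun _
        rw [f.map_add]
        exact (congrArg₂ (· + ·) (e.apply_symm_apply x) (e.apply_symm_apply y)).symm
      map_sup := fun x y => e.symm_apply_eq.2 <| by
        change x ⊔ y = f.toFun _
        rw [f.map_sup]
        exact (congrArg₂ (· ⊔ ·) (e.apply_symm_apply x) (e.apply_symm_apply y)).symm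
      map_inf := fun x y => e.symm_apply_eq.2 <| by
        change x ⊓ y = f.toFun _
        rw [f.map_inf]
        exact (congrArg₂ (· ⊓ ·) (e.apply_symm_apply x) (e.apply_symm_apply y)).symm }
  hom_inv_id := Hom.ext (funext (Equiv.ofBijective f.toFun hf).symm_apply_apply)
  inv_hom_id := Hom.ext (funext (Equiv.ofBijective f.toFun hf).apply_symm_apply)

end AbLGroup

/-! ### `ρ` is an equivalence -/

/-- The semifield `H ∪ {0}` of an abelian ℓ-group `H`, written multiplicatively: the sum is the
join, and `0` is an adjoined least element. -/
@[reducible]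
noncomputable def withZeroSemifield (H : Type u) [CommGroup H] [Lattice H] [IsOrderedMonoid H] :
    Semifield (WithZero H) where
  __ := (inferInstance : CommGroupWithZero (WithZero H))
  add x y := x ⊔ y
  add_assoc := sup_assoc
  zero_add _ := bot_sup_eq _
  add_zero _ := sup_bot_eq _
  add_comm := sup_comm
  nsmul := @nsmulRec _ ⟨0⟩ ⟨fun x y => x ⊔ y⟩
  nsmul_zero _ := rfl
  nsmul_succ _ _ := rfl
  left_distrib a b c := by
    change a * (b ⊔ c) = a * b ⊔ a * c
    rcases eq_or_ne a 0 with rfl | ha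
    · simp
    · exact mul_sup₀ zero_le _ _
  right_distrib a b c := by
    change (a ⊔ b) * c = a * c ⊔ b * c
    rcases eq_or_ne c 0 with rfl | hc
    · simp
    · exact sup_mul₀ zero_le _ _
  nnqsmul := _
  nnqsmul_def _ _ := rfl

namespace AbLGroup

/-- The lattice `G`, written multiplicatively. -/
@[reducible]
def multiplicativeLattice (G : AbLGroup.{u}) : Lattice (Multiplicative G.carrier) :=
  inferInstanceAs (Lattice G.carrier)

/-- The idempotent semifield `G ∪ {0}` of an abelian ℓ-group `G`. -/
noncomputable def withZero (G : AbLGroup.{u}) : IdemSemifield.{u} :=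
  letI := G.multiplicativeLattice
  letI : IsOrderedMonoid (Multiplicative G.carrier) := Multiplicative.isOrderedMonoid
  letI := withZeroSemifield (Multiplicative G.carrier)
  { carrier := WithZero (Multiplicative G.carrier)
    add_self := fun x => sup_idem x }

/-- An element of `G` as a nonzero element of `G ∪ {0}`. -/
noncomputable def toUnit (G : AbLGroup.{u}) (g : G.carrier) : (G.withZero.carrier)ˣ :=
  Units.mk0 (WithZero.coe (Multiplicative.ofAdd g) : WithZero (Multiplicative G.carrier))
    WithZero.coe_ne_zero

/-- The comparison homomorphism from `G` to the nonzero elements of `G ∪ {0}`. -/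
noncomputable def toRhoWithZero (G : AbLGroup.{u}) : Hom G (rho.obj G.withZero) :=
  Hom.ofSup (G := G) (H := rho.obj G.withZero)
    (AddMonoidHom.mk' (fun g => (Additive.ofMul (G.toUnit g) : Additive (G.withZero.carrier)ˣ))
      fun _ _ => congrArg Additive.ofMul (Units.ext rfl))
    fun _ _ => congrArg Additive.ofMul (Units.ext rfl)

theorem toRhoWithZero_bijective (G : AbLGroup.{u}) :
    Function.Bijective G.toRhoWithZero.toFun := by
  constructor
  · intro g h hgh
    have : G.toUnit g = G.toUnit h := Additive.ofMul.injective hgh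
    exact Multiplicative.ofAdd.injective (WithZero.coe_injective (congrArg Units.val this))
  · intro x
    let y : (G.withZero.carrier)ˣ := Additive.toMul (x : Additive (G.withZero.carrier)ˣ)
    obtain ⟨g, hg⟩ := WithZero.ne_zero_iff_exists.1
      (show (y.val : WithZero (Multiplicative G.carrier)) ≠ 0 from y.ne_zero)
    exact ⟨g.toAdd, congrArg Additive.ofMul (Units.ext hg)⟩

end AbLGroup

/-! ### Full faithfulness of `ρ`. -/

namespace IdemSemifield

variable {F K : IdemSemifield.{u}}

theorem rhoMap_injective {f g : F.carrier →+* K.carrier} (h : rhoMap f = rhoMap g) : f = g := by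
  ext x
  rcases eq_or_ne x 0 with rfl | hx
  · simp
  · have := congrFun h (Additive.ofMul (Units.mk0 x hx))
    exact congrArg Units.val (Additive.ofMul.injective this)

open Classical in
/-- The extension by zero of a map between the nonzero elements. -/
noncomputable def extendZero (h : Additive (F.carrier)ˣ → Additive (K.carrier)ˣ)
    (x : F.carrier) : K.carrier :=
  if hx : x = 0 then 0 else (h (Additive.ofMul (Units.mk0 x hx))).toMul

theorem extendZero_zero (h : Additive (F.carrier)ˣ → Additive (K.carrier)ˣ) :
    extendZero h 0 = 0 := dif_pos rfl

theorem extendZero_units (h : Additive (F.carrier)ˣ → Additive (K.carrier)ˣ) (x : (F.carrier)ˣ) :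
    extendZero h (x : F.carrier) = (h (Additive.ofMul x)).toMul := by
  rw [extendZero, dif_neg x.ne_zero, Units.mk0_val]

/-- The extension by zero of an additive map that preserves joins is a semiring homomorphism. -/
noncomputable def extendHom (h : Additive (F.carrier)ˣ →+ Additive (K.carrier)ˣ)
    (hsup : ∀ x y, h (F.unitsLattice.sup x y) = K.unitsLattice.sup (h x) (h y)) :
    F.carrier →+* K.carrier where
  toFun := extendZero h
  map_one' := by
    rw [← Units.val_one, extendZero_units, ofMul_one, map_zero, toMul_zero, Units.val_one]
  map_zero' := extendZero_zero _
  map_mul' x y := by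
    rcases eq_or_ne x 0 with rfl | hx
    · rw [zero_mul, extendZero_zero, zero_mul]
    rcases eq_or_ne y 0 with rfl | hy
    · rw [mul_zero, extendZero_zero, mul_zero]
    lift x to (F.carrier)ˣ using hx.isUnit
    lift y to (F.carrier)ˣ using hy.isUnit
    rw [← Units.val_mul, extendZero_units, extendZero_units, extendZero_units, ofMul_mul, map_add,
      toMul_add, Units.val_mul]
  map_add' x y := by
    rcases eq_or_ne x 0 with rfl | hx
    · rw [zero_add, extendZero_zero, zero_add]
    rcases eq_or_ne y 0 with rfl | hy
    · rw [add_zero, extendZero_zero, add_zero]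
    lift x to (F.carrier)ˣ using hx.isUnit
    lift y to (F.carrier)ˣ using hy.isUnit
    rw [← val_unitsAdd, extendZero_units, extendZero_units, extendZero_units]
    exact congrArg (fun x : Additive (K.carrier)ˣ => (x.toMul : K.carrier)) (hsup _ _)

theorem rhoMap_extendHom (h : Additive (F.carrier)ˣ →+ Additive (K.carrier)ˣ)
    (hsup : ∀ x y, h (F.unitsLattice.sup x y) = K.unitsLattice.sup (h x) (h y)) :
    rhoMap (extendHom h hsup) = h :=
  funext fun x => congrArg Additive.ofMul (Units.ext (extendZero_units h x.toMul))

end IdemSemifield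

theorem rho_isEquivalence : rho.{u}.IsEquivalence where
  faithful := ⟨fun {_ _ _ _} h => IdemSemifield.Hom.ext
    (IdemSemifield.rhoMap_injective (congrArg AbLGroup.Hom.toFun h))⟩
  full := ⟨fun {F K} h =>
    ⟨⟨IdemSemifield.extendHom (F := F) (K := K) h.toAddMonoidHom h.map_sup⟩,
      AbLGroup.Hom.ext (IdemSemifield.rhoMap_extendHom (F := F) (K := K)
        h.toAddMonoidHom h.map_sup)⟩⟩
  essSurj := ⟨fun G =>
    ⟨G.withZero, ⟨(AbLGroup.isoOfBijective _ G.toRhoWithZero_bijective).symm⟩⟩⟩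

/-! ### Arithmetic of MV-algebras -/

namespace MVAlgebra

local infixl:65 "⊕ₘ" => MVAlgebra.oplus
local prefix:max "∼" => MVAlgebra.neg

variable {A : Type u} [MVAlgebra A]

theorem zero_oplus (x : A) : zero ⊕ₘ x = x := by rw [oplus_comm, oplus_zero]

theorem one_oplus (x : A) : one ⊕ₘ x = one := by rw [oplus_comm, oplus_one]

theorem neg_one : ∼(one : A) = zero := by rw [← neg_zero, neg_neg]

theorem neg_injective {x y : A} (h : ∼x = ∼y) : x = y := by
  rw [← neg_neg x, h, neg_neg]

theorem neg_oplus_self (x : A) : ∼x ⊕ₘ x = one := by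
  have := lukasiewicz x one
  rwa [oplus_one, neg_one, zero_oplus, eq_comm] at this

theorem oplus_right_comm (x y z : A) : x ⊕ₘ y ⊕ₘ z = x ⊕ₘ z ⊕ₘ y := by
  rw [oplus_assoc, oplus_comm y, oplus_assoc]

theorem le_iff_neg_oplus {x y : A} : le x y ↔ ∼x ⊕ₘ y = one := by
  constructor
  · rintro ⟨z, rfl⟩
    rw [← oplus_assoc, neg_oplus_self, one_oplus]
  · intro h
    -- The witness is the truncated difference of `y` and `x`.
    refine ⟨∼(∼y ⊕ₘ x), ?_⟩
    have := lukasiewicz x y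
    rwa [h, neg_one, zero_oplus, oplus_comm _ x] at this

variable (A) in
/-- The natural order of an MV-algebra. -/
@[reducible]
def partialOrder : PartialOrder A where
  le := le
  le_refl x := ⟨zero, (oplus_zero x).symm⟩
  le_trans := by
    rintro x _ _ ⟨z, rfl⟩ ⟨w, rfl⟩
    exact ⟨z ⊕ₘ w, oplus_assoc _ _ _⟩
  le_antisymm x y hxy hyx := by
    have := lukasiewicz x y
    rw [le_iff_neg_oplus.1 hxy, le_iff_neg_oplus.1 hyx, neg_one, zero_oplus, zero_oplus] at this
    exact this.symm

section order

attribute [local instance] partialOrder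

theorem le_iff {x y : A} : x ≤ y ↔ ∼x ⊕ₘ y = one := le_iff_neg_oplus

theorem zero_le (x : A) : zero ≤ x := ⟨x, (zero_oplus x).symm⟩

theorem le_one (x : A) : x ≤ one := ⟨one, (oplus_one x).symm⟩

theorem le_oplus_right (x y : A) : x ≤ x ⊕ₘ y := ⟨y, rfl⟩

theorem le_oplus_left (x y : A) : y ≤ x ⊕ₘ y := ⟨x, oplus_comm x y⟩

theorem oplus_le_oplus_right {x y : A} (h : x ≤ y) (z : A) : x ⊕ₘ z ≤ y ⊕ₘ z := by
  obtain ⟨w, rfl⟩ := h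
  exact ⟨w, oplus_right_comm x w z⟩

theorem oplus_le_oplus {x y z w : A} (h : x ≤ y) (h' : z ≤ w) : x ⊕ₘ z ≤ y ⊕ₘ w := by
  refine (oplus_le_oplus_right h z).trans ?_
  rw [oplus_comm y, oplus_comm y]
  exact oplus_le_oplus_right h' y

theorem neg_le_neg {x y : A} (h : x ≤ y) : ∼y ≤ ∼x := by
  rw [le_iff] at h ⊢
  rwa [neg_neg, oplus_comm]

theorem le_neg_comm {x y : A} (h : x ≤ ∼y) : y ≤ ∼x := by
  have := neg_le_neg h
  rwa [neg_neg] at this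

theorem neg_le_comm {x y : A} (h : ∼x ≤ y) : ∼y ≤ x := by
  have := neg_le_neg h
  rwa [neg_neg] at this

end order

variable (A) in
/-- The natural order of an MV-algebra is a lattice order. -/
@[reducible]
def lattice : Lattice A where
  __ := partialOrder A
  sup x y := ∼(∼x ⊕ₘ y) ⊕ₘ y
  inf x y := ∼(∼(x ⊕ₘ ∼y) ⊕ₘ ∼y)
  le_sup_left x y := ⟨∼(∼y ⊕ₘ x), by rw [lukasiewicz, oplus_comm]⟩
  le_sup_right x y := le_oplus_left _ _
  sup_le x y z hx hy := by
    change ∼(∼x ⊕ₘ y) ⊕ₘ y ≤ z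
    -- The map `t ↦ ¬(¬t ⊕ y) ⊕ y` is monotone and fixes every `z ≥ y`.
    have h : ∼(∼z ⊕ₘ y) ⊕ₘ y = z := by
      rw [lukasiewicz, le_iff.1 hy, neg_one, zero_oplus]
    rw [← h]
    exact oplus_le_oplus_right (neg_le_neg (oplus_le_oplus_right (neg_le_neg hx) y)) y
  inf_le_left x y := by
    refine neg_le_comm ?_
    have := lukasiewicz (∼x) (∼y)
    rw [neg_neg, neg_neg] at this
    rw [this]
    exact le_oplus_left _ _
  inf_le_right x y := neg_le_comm (le_oplus_left _ _)
  le_inf x y z hy hz := by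
    refine le_neg_comm ?_
    have h : ∼(∼(∼x) ⊕ₘ ∼z) ⊕ₘ ∼z = ∼x := by
      rw [lukasiewicz, le_iff.1 (neg_le_neg hz), neg_one, zero_oplus]
    rw [neg_neg] at h
    change ∼(y ⊕ₘ ∼z) ⊕ₘ ∼z ≤ ∼x
    rw [← h]
    exact oplus_le_oplus_right (neg_le_neg (oplus_le_oplus_right hy _)) _

attribute [local instance] lattice

/-! ### Truncated difference, prelinearity and the behaviour of doubling. -/

/-- Truncated difference. -/
def ominus (x y : A) : A := ∼(∼x ⊕ₘ y)

local infixl:65 "⊖ₘ" => MVAlgebra.ominus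

theorem ominus_oplus (x y : A) : x ⊖ₘ y ⊕ₘ y = x ⊔ y := rfl

/-- Residuation: both sides unfold to `¬x ⊕ y ⊕ z = 1`. -/
theorem ominus_le_iff {x y z : A} : x ⊖ₘ y ≤ z ↔ x ≤ z ⊕ₘ y := by
  rw [le_iff, le_iff, ominus, neg_neg, oplus_assoc, oplus_comm y]

theorem le_ominus_oplus (x y : A) : x ≤ x ⊖ₘ y ⊕ₘ y := ominus_le_iff.1 le_rfl

theorem ominus_le_self (x y : A) : x ⊖ₘ y ≤ x := ominus_le_iff.2 (le_oplus_right x y)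

theorem ominus_le_neg (x y : A) : x ⊖ₘ y ≤ ∼y := neg_le_neg (le_oplus_left _ _)

/-- The condition `x ≤ ¬y` means that `x ⊕ y` is not truncated at `1`; only such sums can be
cancelled. -/
theorem neg_oplus_oplus_of_le {x y : A} (h : x ≤ ∼y) : ∼(x ⊕ₘ y) ⊕ₘ y = ∼x := by
  have := lukasiewicz (∼x) y
  rwa [neg_neg, le_iff.1 (le_neg_comm h), neg_one, zero_oplus] at this

theorem le_of_oplus_le_oplus {x y z : A} (hx : x ≤ ∼z) (hy : y ≤ ∼z) (h : x ⊕ₘ z ≤ y ⊕ₘ z) :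
    x ≤ y := by
  have := oplus_le_oplus_right (neg_le_neg h) z
  rw [neg_oplus_oplus_of_le hx, neg_oplus_oplus_of_le hy] at this
  simpa only [neg_neg] using neg_le_neg this

/-- With `c` the meet of the differences and `m = x ⊓ y`, the sum `c ⊕ m` lies below both `x` and
`y`, hence below `m`. It is not truncated, so `m` cancels. -/
theorem ominus_inf_ominus (x y : A) : (x ⊖ₘ y) ⊓ (y ⊖ₘ x) = zero := by
  set c := (x ⊖ₘ y) ⊓ (y ⊖ₘ x)
  set m := x ⊓ y
  have hx : c ⊕ₘ m ≤ x := by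
    calc c ⊕ₘ m ≤ x ⊖ₘ m ⊕ₘ m := oplus_le_oplus_right (inf_le_left.trans <| neg_le_neg <|
            oplus_le_oplus le_rfl inf_le_right) m
      _ = x := sup_eq_left.2 inf_le_left
  have hy : c ⊕ₘ m ≤ y := by
    calc c ⊕ₘ m ≤ y ⊖ₘ m ⊕ₘ m := oplus_le_oplus_right (inf_le_right.trans <| neg_le_neg <|
            oplus_le_oplus le_rfl inf_le_left) m
      _ = y := sup_eq_left.2 inf_le_right
  have hc : c ≤ ∼m := inf_le_left.trans ((ominus_le_neg x y).trans (neg_le_neg inf_le_right))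
  refine le_antisymm (le_of_oplus_le_oplus hc (zero_le _) ?_) (zero_le c)
  rw [zero_oplus]
  exact le_inf hx hy

/-- Prelinearity, as a principle for proving inequalities. -/
theorem le_of_le_ominus_oplus {w t : A} (x y : A) (h₁ : w ≤ x ⊖ₘ y ⊕ₘ t)
    (h₂ : w ≤ y ⊖ₘ x ⊕ₘ t) : w ≤ t := by
  -- By residuation `w ⊖ t` lies below both differences, whose meet is `0`.
  have := le_inf (ominus_le_iff.2 h₁) (ominus_le_iff.2 h₂)
  rwa [ominus_inf_ominus, ominus_le_iff, zero_oplus] at this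

theorem sup_oplus (x y z : A) : (x ⊔ y) ⊕ₘ z = (x ⊕ₘ z) ⊔ (y ⊕ₘ z) := by
  refine le_antisymm (le_of_le_ominus_oplus x y ?_ ?_)
    (sup_le (oplus_le_oplus_right le_sup_left z) (oplus_le_oplus_right le_sup_right z))
  · rw [← ominus_oplus, oplus_assoc]
    exact oplus_le_oplus le_rfl le_sup_right
  · rw [sup_comm, ← ominus_oplus, oplus_assoc]
    exact oplus_le_oplus le_rfl le_sup_left

/-- Clear when `x` and `y` are comparable; prelinearity reduces to that situation. -/
theorem oplus_le_sup (x y : A) : x ⊕ₘ y ≤ (x ⊕ₘ x) ⊔ (y ⊕ₘ y) := by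
  refine le_of_le_ominus_oplus x y ?_ ?_
  · refine (oplus_le_oplus_right (le_ominus_oplus x y) y).trans ?_
    rw [oplus_assoc]
    exact oplus_le_oplus le_rfl le_sup_right
  · rw [oplus_comm x]
    refine (oplus_le_oplus_right (le_ominus_oplus y x) x).trans ?_
    rw [oplus_assoc]
    exact oplus_le_oplus le_rfl le_sup_left

theorem sup_oplus_sup_self (x y : A) : (x ⊔ y) ⊕ₘ (x ⊔ y) = (x ⊕ₘ x) ⊔ (y ⊕ₘ y) := by
  refine le_antisymm ?_ (sup_le (oplus_le_oplus le_sup_left le_sup_left)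
    (oplus_le_oplus le_sup_right le_sup_right))
  rw [sup_oplus, oplus_comm x, oplus_comm y, sup_oplus, sup_oplus]
  refine sup_le (sup_le le_sup_left ?_) (sup_le (oplus_le_sup x y) le_sup_right)
  rw [oplus_comm]
  exact oplus_le_sup x y

/-- Intuitively, two elements that are at most one half have an untruncated sum. -/
theorem le_neg_of_le_neg_self {x y : A} (hx : x ≤ ∼x) (hy : y ≤ ∼y) : x ≤ ∼y := by
  refine le_of_le_ominus_oplus x y ?_ ?_
  · exact (le_ominus_oplus x y).trans (oplus_le_oplus le_rfl hy)
  -- Here `(y ⊖ x) ⊕ ¬y` is the join of `¬x` and `¬y`, so it lies above `¬x ≥ x`.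
  · have := lukasiewicz (∼x) (∼y)
    rw [neg_neg, neg_neg, oplus_comm x] at this
    rw [ominus, this]
    exact hx.trans (le_oplus_left _ _)

theorem sup_le_neg_sup {x y : A} (hx : x ≤ ∼x) (hy : y ≤ ∼y) : x ⊔ y ≤ ∼(x ⊔ y) :=
  sup_le (le_neg_comm (sup_le hx (le_neg_of_le_neg_self hy hx)))
    (le_neg_comm (sup_le (le_neg_of_le_neg_self hx hy) hy))

/-! ### The radical -/

theorem nmul_add (m n : ℕ) (x : A) : nmul (m + n) x = nmul m x ⊕ₘ nmul n x := by
  induction n with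
  | zero => exact (oplus_zero _).symm
  | succ n ih =>
    change nmul (m + n) x ⊕ₘ x = nmul m x ⊕ₘ (nmul n x ⊕ₘ x)
    rw [ih, oplus_assoc]

/-- Associativity of untruncated addition: a summand may move from one side to the other. -/
theorem oplus_le_neg_of_oplus_le_neg {x y z : A} (h : x ≤ ∼y) (h' : x ⊕ₘ y ≤ ∼z) :
    x ≤ ∼(z ⊕ₘ y) := by
  refine le_neg_comm ?_
  refine (oplus_le_oplus_right (le_neg_comm h') y).trans ?_
  rw [neg_oplus_oplus_of_le h]

theorem nmul_le_neg_nmul {x : A} (hx : x ∈ rad A) (m n : ℕ) : nmul m x ≤ ∼(nmul n x) := by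
  induction n generalizing m with
  | zero =>
    change _ ≤ ∼zero
    rw [neg_zero]
    exact le_one _
  | succ n ih =>
    -- One copy of `x` moves across: the claim for `(m, n + 1)` follows from that for `(m + 1, n)`.
    refine oplus_le_neg_of_oplus_le_neg ?_ (ih (m + 1))
    rcases Nat.eq_zero_or_pos m with rfl | hm
    · exact zero_le _
    · exact hx m hm

theorem iterate_double (k : ℕ) (x : A) : (fun y : A => y ⊕ₘ y)^[k] x = nmul (2 ^ k) x := by
  induction k with
  | zero => exact (zero_oplus x).symm
  | succ k ih => rw [Function.iterate_succ_apply', ih, ← nmul_add, pow_succ, mul_two]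

theorem monotone_double : Monotone (fun y : A => y ⊕ₘ y) := fun _ _ h => oplus_le_oplus h h

theorem nmul_le_iterate_double (n : ℕ) (x : A) : nmul n x ≤ (fun y : A => y ⊕ₘ y)^[n] x ∧
    x ≤ (fun y : A => y ⊕ₘ y)^[n] x := by
  induction n with
  | zero => exact ⟨zero_le x, le_rfl⟩
  | succ n ih =>
    rw [Function.iterate_succ_apply']
    exact ⟨oplus_le_oplus ih.1 ih.2, ih.2.trans (le_oplus_right _ _)⟩

/-- Testing only the multiples `2 ^ k x` suffices, and iterated doubling commutes with joins by
`sup_oplus_sup_self`. -/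
theorem mem_rad_iff {x : A} : x ∈ rad A ↔
    ∀ k, (fun y : A => y ⊕ₘ y)^[k] x ≤ ∼((fun y : A => y ⊕ₘ y)^[k] x) := by
  constructor
  · intro hx k
    rw [iterate_double]
    exact nmul_le_neg_nmul hx _ _
  · intro h n _
    obtain ⟨h₁, h₂⟩ := nmul_le_iterate_double n x
    exact h₁.trans ((h n).trans (neg_le_neg h₂))

theorem le_neg_self_of_mem_rad {x : A} (hx : x ∈ rad A) : x ≤ ∼x := mem_rad_iff.1 hx 0

theorem le_neg_of_mem_rad {x y : A} (hx : x ∈ rad A) (hy : y ∈ rad A) : x ≤ ∼y :=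
  le_neg_of_le_neg_self (le_neg_self_of_mem_rad hx) (le_neg_self_of_mem_rad hy)

theorem mem_rad_of_le {x y : A} (h : x ≤ y) (hy : y ∈ rad A) : x ∈ rad A :=
  mem_rad_iff.2 fun k =>
    have hk := monotone_double.iterate k h
    hk.trans ((mem_rad_iff.1 hy k).trans (neg_le_neg hk))

theorem zero_mem_rad : (zero : A) ∈ rad A := fun _ _ => by
  rw [neg_zero]
  exact le_one _

theorem sup_mem_rad {x y : A} (hx : x ∈ rad A) (hy : y ∈ rad A) : x ⊔ y ∈ rad A := by
  refine mem_rad_iff.2 fun k => ?_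
  have h : (fun z : A => z ⊕ₘ z)^[k] (x ⊔ y) =
      (fun z : A => z ⊕ₘ z)^[k] x ⊔ (fun z : A => z ⊕ₘ z)^[k] y := by
    induction k with
    | zero => rfl
    | succ k ih =>
      simp only [Function.iterate_succ_apply', ih]
      exact sup_oplus_sup_self _ _
  rw [h]
  exact sup_le_neg_sup (mem_rad_iff.1 hx k) (mem_rad_iff.1 hy k)

theorem oplus_mem_rad {x y : A} (hx : x ∈ rad A) (hy : y ∈ rad A) : x ⊕ₘ y ∈ rad A := by
  refine mem_rad_of_le (oplus_le_oplus (le_sup_left : x ≤ x ⊔ y) (le_sup_right : y ≤ x ⊔ y)) ?_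
  -- The double of an infinitesimal is infinitesimal: its criterion is the original one shifted by
  -- one.
  exact mem_rad_iff.2 fun k => mem_rad_iff.1 (sup_mem_rad hx hy) (k + 1)

/-- The infinitesimals and their negations already form a subalgebra, because the radical is closed
under sums and downwards. -/
theorem mem_rad_or_neg_mem_rad (hA : IsPerfect A) (x : A) : x ∈ rad A ∨ ∼x ∈ rad A := by
  have key : ∀ {x y : A}, ∼x ∈ rad A → ∼(x ⊕ₘ y) ∈ rad A := fun {x y} h =>
    mem_rad_of_le (neg_le_neg (le_oplus_right x y)) h
  induction hA.2 x with
  | of h => exact .inl h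
  | zero => exact .inl zero_mem_rad
  | one => exact .inr (neg_one (A := A) ▸ zero_mem_rad)
  | oplus _ _ hx hy =>
    rcases hx with hx | hx
    · rcases hy with hy | hy
      · exact .inl (oplus_mem_rad hx hy)
      · rw [oplus_comm]
        exact .inr (key hy)
    · exact .inr (key hx)
  | neg _ hx =>
    rw [neg_neg]
    exact hx.symm

/-- Otherwise `¬x ⊕ x = 1` would be infinitesimal, forcing `1 ≤ 0`. -/
theorem neg_notMem_rad (hA : IsPerfect A) {x : A} (hx : x ∈ rad A) : ∼x ∉ rad A := fun h => by
  have := le_neg_self_of_mem_rad (oplus_mem_rad h hx)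
  rw [neg_oplus_self, neg_one] at this
  exact hA.1 (le_antisymm (zero_le _) this)

end MVAlgebra

/-! ### The ℓ-group of differences of a cancellative lattice-ordered monoid -/

/-- A partially ordered abelian group in which any two elements have a least upper bound is
an ℓ-group. -/
@[reducible]
noncomputable def latticeOfExistsIsLUB {G : Type u} [AddCommGroup G] [PartialOrder G]
    [IsOrderedAddMonoid G] (h : ∀ x y : G, ∃ z, IsLUB {x, y} z) : Lattice G where
  sup x y := (h x y).choose
  inf x y := -(h (-x) (-y)).choose
  le_sup_left x y := (h x y).choose_spec.1 (by simp)
  le_sup_right x y := (h x y).choose_spec.1 (by simp)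
  sup_le x y z hx hy := (h x y).choose_spec.2 (by simp [hx, hy])
  inf_le_left x y := neg_le.1 ((h (-x) (-y)).choose_spec.1 (by simp))
  inf_le_right x y := neg_le.1 ((h (-x) (-y)).choose_spec.1 (by simp))
  le_inf x y z hy hz := le_neg.1 ((h (-y) (-z)).choose_spec.2 (by simp [hy, hz]))

namespace Algebra.GrothendieckAddGroup

variable {M : Type u} [AddCommMonoid M]

theorem mk_eq_of_sub_of (a : M) (b : (⊤ : AddSubmonoid M)) :
    (AddLocalization.mk a b : GrothendieckAddGroup M) = of a - of (b : M) := by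
  rw [eq_sub_iff_add_eq]
  simp only [of, AddSubmonoid.LocalizationMap.toAddMonoidHom_apply,
    ← AddLocalization.mk_zero_eq_addMonoidOf_mk, AddLocalization.mk_add]
  rw [AddLocalization.mk_eq_mk_iff, AddLocalization.r_iff_exists]
  exact ⟨0, by simp [add_comm]⟩

theorem exists_eq_of_sub_of (x : GrothendieckAddGroup M) : ∃ a b : M, x = of a - of b := by
  induction x using AddLocalization.ind with
  | H y => exact ⟨y.1, y.2, mk_eq_of_sub_of _ _⟩

section order

variable [PartialOrder M] [IsOrderedCancelAddMonoid M]

theorem of_le_of {a b : M} : (of a : GrothendieckAddGroup M) ≤ of b ↔ a ≤ b := by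
  simp only [of, AddSubmonoid.LocalizationMap.toAddMonoidHom_apply,
    ← AddLocalization.mk_zero_eq_addMonoidOf_mk, AddLocalization.mk_le_mk]
  simp

theorem of_le_of_sub_of {a p q : M} :
    (of a : GrothendieckAddGroup M) ≤ of p - of q ↔ a + q ≤ p := by
  rw [le_sub_iff_add_le, ← map_add, of_le_of]

end order

section sup

variable [SemilatticeSup M] [IsOrderedCancelAddMonoid M]

/-- Comparison with an upper bound `p - q` is translated by `q` into `M`, where distributivity
applies. -/
theorem isLUB_of_sup (h : ∀ a b c : M, (a ⊔ b) + c = (a + c) ⊔ (b + c)) (a b : M) :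
    IsLUB {(of a : GrothendieckAddGroup M), of b} (of (a ⊔ b)) := by
  constructor
  · rintro x (rfl | rfl)
    · exact of_le_of.2 le_sup_left
    · exact of_le_of.2 le_sup_right
  · intro z hz
    obtain ⟨p, q, rfl⟩ := exists_eq_of_sub_of z
    have ha : a + q ≤ p := of_le_of_sub_of.1 (hz (by simp))
    have hb : b + q ≤ p := of_le_of_sub_of.1 (hz (by simp))
    rw [of_le_of_sub_of, h]
    exact sup_le ha hb

theorem exists_isLUB (h : ∀ a b c : M, (a ⊔ b) + c = (a + c) ⊔ (b + c))
    (x y : GrothendieckAddGroup M) : ∃ z, IsLUB {x, y} z := by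
  obtain ⟨a, b, rfl⟩ := exists_eq_of_sub_of x
  obtain ⟨c, d, rfl⟩ := exists_eq_of_sub_of y
  -- Translation by `b + d` turns `a - b` and `c - d` into elements of `M`.
  have hl := isLUB_of_sup h (a + d) (c + b)
  refine ⟨of ((a + d) ⊔ (c + b)) - of (b + d), ?_, fun z hz => ?_⟩
  · have h₁ := hl.1 (Set.mem_insert _ _)
    have h₂ := hl.1 (Set.mem_insert_of_mem _ rfl)
    rintro x (rfl | rfl)
    · rw [le_sub_iff_add_le]
      convert! h₁ using 1
      simp only [map_add]
      abel
    · rw [le_sub_iff_add_le]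
      convert! h₂ using 1
      simp only [map_add]
      abel
  · have h₁ : of a - of b ≤ z := hz (by simp)
    have h₂ : of c - of d ≤ z := hz (by simp)
    rw [sub_le_iff_le_add] at h₁ h₂ ⊢
    refine hl.2 ?_
    rintro x (rfl | rfl)
    · rw [map_add, map_add, ← add_assoc]
      exact add_le_add_left h₁ _
    · rw [map_add, map_add, add_comm (of b), ← add_assoc]
      exact add_le_add_left h₂ _

end sup

end Algebra.GrothendieckAddGroup

/-! ### The ℓ-group of a perfect MV-algebra -/

namespace MVAlgebra

open Algebra

variable {A : Type u} [MVAlgebra A]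

attribute [local instance] lattice

variable (A) in
/-- The infinitesimals form a commutative monoid. -/
@[reducible]
def radMonoid : AddCommMonoid (rad A) where
  add x y := ⟨oplus x.1 y.1, oplus_mem_rad x.2 y.2⟩
  zero := ⟨zero, zero_mem_rad⟩
  add_assoc _ _ _ := Subtype.ext (oplus_assoc _ _ _)
  add_comm _ _ := Subtype.ext (oplus_comm _ _)
  zero_add _ := Subtype.ext (zero_oplus _)
  add_zero _ := Subtype.ext (oplus_zero _)
  nsmul := @nsmulRec _ ⟨⟨zero, zero_mem_rad⟩⟩ ⟨fun x y => ⟨oplus x.1 y.1, oplus_mem_rad x.2 y.2⟩⟩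
  nsmul_zero _ := rfl
  nsmul_succ _ _ := rfl

variable (A) in
/-- The infinitesimals form a join-semilattice. -/
@[reducible]
def radSemilatticeSup : SemilatticeSup (rad A) :=
  Subtype.semilatticeSup fun _ _ hx hy => sup_mem_rad hx hy

attribute [local instance] radMonoid radSemilatticeSup

variable (A) in
-- Sums of two infinitesimals are never truncated, so they cancel.
theorem rad_isOrderedCancelAddMonoid : IsOrderedCancelAddMonoid (rad A) where
  add_le_add_left _ _ h z := oplus_le_oplus_right h z.1
  le_of_add_le_add_left x y z h := by
    refine le_of_oplus_le_oplus (le_neg_of_mem_rad y.2 x.2) (le_neg_of_mem_rad z.2 x.2) ?_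
    rw [oplus_comm y.1, oplus_comm z.1]
    exact h

attribute [local instance] rad_isOrderedCancelAddMonoid

theorem rad_sup_add (x y z : rad A) : (x ⊔ y) + z = (x + z) ⊔ (y + z) :=
  Subtype.ext (sup_oplus x.1 y.1 z.1)

variable (A) in
/-- The ℓ-group of differences of infinitesimals. -/
noncomputable def radGroup : AbLGroup.{u} :=
  { carrier := GrothendieckAddGroup (rad A)
    lattice := latticeOfExistsIsLUB (GrothendieckAddGroup.exists_isLUB rad_sup_add)
    isOrdered := inferInstanceAs (IsOrderedAddMonoid (GrothendieckAddGroup (rad A))) }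

/-- An infinitesimal as an element of the ℓ-group of differences. -/
noncomputable def ofRad (x : A) (hx : x ∈ rad A) : (radGroup A).carrier :=
  GrothendieckAddGroup.of (⟨x, hx⟩ : rad A)

theorem ofRad_injective {x y : A} {hx : x ∈ rad A} {hy : y ∈ rad A}
    (h : ofRad x hx = ofRad y hy) : x = y :=
  congrArg Subtype.val (GrothendieckAddGroup.of_injective (M := rad A) h)

theorem ofRad_oplus {x y : A} (hx : x ∈ rad A) (hy : y ∈ rad A) :
    ofRad (oplus x y) (oplus_mem_rad hx hy) = ofRad x hx + ofRad y hy :=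
  map_add (GrothendieckAddGroup.of (M := rad A)) ⟨x, hx⟩ ⟨y, hy⟩

theorem ofRad_zero : ofRad (zero : A) zero_mem_rad = 0 :=
  map_zero (GrothendieckAddGroup.of (M := rad A))

theorem ofRad_sup {x y : A} (hx : x ∈ rad A) (hy : y ∈ rad A) :
    ofRad (x ⊔ y) (sup_mem_rad hx hy) = ofRad x hx ⊔ ofRad y hy :=
  (GrothendieckAddGroup.isLUB_of_sup rad_sup_add (⟨x, hx⟩ : rad A) ⟨y, hy⟩).unique
    (isLUB_pair (γ := (radGroup A).carrier) (a := ofRad x hx) (b := ofRad y hy))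

theorem ofRad_nonneg {x : A} (hx : x ∈ rad A) : 0 ≤ ofRad x hx := by
  rw [← ofRad_zero]
  exact GrothendieckAddGroup.of_le_of.2 (zero_le x)

/-- If `b ≤ a` then `a = b ⊕ c`, and `c ≤ a` is again infinitesimal; so passing to differences adds
no new positive elements. -/
theorem exists_ofRad_of_nonneg {g : (radGroup A).carrier} (hg : 0 ≤ g) :
    ∃ x, ∃ hx : x ∈ rad A, ofRad x hx = g := by
  obtain ⟨⟨a, ha⟩, ⟨b, hb⟩, rfl⟩ :=
    GrothendieckAddGroup.exists_eq_of_sub_of (g : GrothendieckAddGroup (rad A))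
  have h : ofRad b hb ≤ ofRad a ha := sub_nonneg.1 hg
  obtain ⟨c, rfl⟩ : b ≤ a :=
    (GrothendieckAddGroup.of_le_of (a := (⟨b, hb⟩ : rad A)) (b := ⟨a, ha⟩)).1 h
  have hc : c ∈ rad A := mem_rad_of_le (le_oplus_left b c) ha
  exact ⟨c, hc, eq_sub_of_add_eq' (ofRad_oplus hb hc).symm⟩

theorem ominus_mem_rad {x : A} (hx : x ∈ rad A) (y : A) : ominus x y ∈ rad A :=
  mem_rad_of_le (ominus_le_self x y) hx

/-- Subtract `y` from `(x ⊖ y) ⊕ y = x ⊔ y`. -/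
theorem ofRad_ominus {x y : A} (hx : x ∈ rad A) (hy : y ∈ rad A) :
    ofRad (ominus x y) (ominus_mem_rad hx y) = (ofRad x hx - ofRad y hy) ⊔ 0 := by
  have h := (ofRad_oplus (ominus_mem_rad hx y) hy).symm.trans (ofRad_sup hx hy)
  rw [eq_sub_of_add_eq h, sub_eq_add_neg, sup_add, ← sub_eq_add_neg, add_neg_cancel]

end MVAlgebra

/-! ### The elements of `Δ(G)` -/

section lex

variable {G : Type u} [Lattice G]

attribute [local instance] lexLattice

theorem toLex_inf_toLex_of_lt {m n : ℤ} (h : m < n) (a b : G) :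
    (toLex (m, a) : ℤ ×ₗ G) ⊓ toLex (n, b) = toLex (m, a) := if_pos h

theorem toLex_inf_toLex_of_gt {m n : ℤ} (h : n < m) (a b : G) :
    (toLex (m, a) : ℤ ×ₗ G) ⊓ toLex (n, b) = toLex (n, b) := by
  rw [inf_comm, toLex_inf_toLex_of_lt h]

theorem toLex_inf_toLex (n : ℤ) (a b : G) :
    (toLex (n, a) : ℤ ×ₗ G) ⊓ toLex (n, b) = toLex (n, a ⊓ b) :=
  (if_neg (lt_irrefl n)).trans (if_neg (lt_irrefl n))

end lex

namespace AbLGroup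

open MVAlgebra

variable {G H : AbLGroup.{u}}

variable (G) in
/-- The underlying MV-algebra of `Δ(G)`. -/
noncomputable abbrev mvAlg : MVAlg.{u} := (lexZFunctor ⋙ Gamma).obj G

/-- The infinitesimal `(0, g)` of `Δ(G)`, for `g ≥ 0`. -/
noncomputable def low (g : G.carrier) (hg : 0 ≤ g) : G.mvAlg.carrier :=
  (⟨(toLex (0, g) : ℤ ×ₗ G.carrier), Prod.Lex.le_iff.2 (.inr ⟨rfl, hg⟩),
    Prod.Lex.le_iff.2 (.inl one_pos)⟩ :
    letI := lexLattice G.carrier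
    Set.Icc (0 : ℤ ×ₗ G.carrier) (toLex (1, 0)))

/-- The pair in `ℤ × G` underlying an element of `Δ(G)`. -/
def toPair (x : G.mvAlg.carrier) : ℤ ×ₗ G.carrier :=
  letI := lexLattice G.carrier
  Subtype.val (x : Set.Icc (0 : ℤ ×ₗ G.carrier) (toLex (1, 0)))

theorem toPair_injective {x y : G.mvAlg.carrier} (h : toPair x = toPair y) : x = y :=
  Subtype.ext h

theorem toPair_low (g : G.carrier) (hg : 0 ≤ g) : toPair (low g hg) = toLex (0, g) := rfl

theorem toPair_neg (x : G.mvAlg.carrier) : toPair (neg x) = toLex (1, 0) - toPair x := rfl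

theorem toPair_oplus (x y : G.mvAlg.carrier) : toPair (oplus x y) =
    (lexLattice G.carrier).inf (toPair x + toPair y) (toLex (1, 0)) := rfl

theorem toPair_neg_low (g : G.carrier) (hg : 0 ≤ g) :
    toPair (neg (low g hg)) = toLex (1, -g) :=
  congrArg toLex (Prod.ext (sub_zero 1) (zero_sub g))

theorem low_injective {g h : G.carrier} {hg : 0 ≤ g} {hh : 0 ≤ h} (e : low g hg = low h hh) :
    g = h :=
  congrArg (fun x => (ofLex (toPair x)).2) e

theorem low_congr {g h : G.carrier} (e : g = h) (hg : 0 ≤ g) (hh : 0 ≤ h) :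
    low g hg = low h hh := by
  subst e
  rfl

/-- The integer coordinate decides truncation by `(1, 0)`: at `0` nothing happens, at `2` the result
is `1`, and at `1` the meet is taken in `G`. -/
theorem low_oplus_low (g h : G.carrier) (hg : 0 ≤ g) (hh : 0 ≤ h) :
    oplus (low g hg) (low h hh) = low (g + h) (add_nonneg hg hh) :=
  toPair_injective (toLex_inf_toLex_of_lt (one_pos : (0 + 0 : ℤ) < 1) _ _)

theorem low_zero : low (0 : G.carrier) le_rfl = zero := rfl

theorem neg_low_oplus_neg_low (g h : G.carrier) (hg : 0 ≤ g) (hh : 0 ≤ h) :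
    oplus (neg (low g hg)) (neg (low h hh)) = one := by
  apply toPair_injective
  rw [toPair_oplus, toPair_neg_low, toPair_neg_low]
  exact toLex_inf_toLex_of_gt (one_lt_two : (1 : ℤ) < 1 + 1) _ _

theorem low_ominus_low (g h : G.carrier) (hg : 0 ≤ g) (hh : 0 ≤ h) :
    ominus (low g hg) (low h hh) = low ((g - h) ⊔ 0) le_sup_right := by
  apply toPair_injective
  rw [ominus, toPair_neg, toPair_oplus, toPair_neg_low, toPair_low, toPair_low]
  have : (lexLattice G.carrier).inf (toLex (1, -g) + toLex (0, h)) (toLex (1, 0)) =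
      toLex (1, (-g + h) ⊓ 0) := toLex_inf_toLex 1 (-g + h) 0
  rw [this]
  refine congrArg toLex (Prod.ext (sub_self 1) ?_)
  change 0 - (-g + h) ⊓ 0 = (g - h) ⊔ 0
  rw [zero_sub, neg_inf, _root_.neg_zero]
  congr 1
  abel

theorem exists_eq_low_or_neg_low (x : G.mvAlg.carrier) :
    (∃ g hg, x = low g hg) ∨ ∃ g hg, x = neg (low g hg) := by
  obtain ⟨⟨n, g⟩, h₀, h₁⟩ := (x : letI := lexLattice G.carrier
    Set.Icc (0 : ℤ ×ₗ G.carrier) (toLex (1, 0)))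
  rcases Prod.Lex.le_iff.1 h₀ with h | ⟨h, hg⟩
  · rcases Prod.Lex.le_iff.1 h₁ with h' | ⟨h', hg⟩
    · change (0 : ℤ) < n at h
      change n < (1 : ℤ) at h'
      omega
    · obtain rfl : n = 1 := h'
      change g ≤ 0 at hg
      refine .inr ⟨-g, neg_nonneg.2 hg, toPair_injective ?_⟩
      rw [toPair_neg_low, _root_.neg_neg]
      rfl
  · obtain rfl : (0 : ℤ) = n := h
    exact .inl ⟨g, hg, rfl⟩

theorem low_mem_rad (g : G.carrier) (hg : 0 ≤ g) : low g hg ∈ rad G.mvAlg.carrier := by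
  let _ := lexLattice G.carrier
  refine intervalMV_infinitesimal (G := ℤ ×ₗ G.carrier) (u := toLex (1, 0))
    (Prod.Lex.le_iff.2 (.inl one_pos)) _ fun n => Prod.Lex.le_iff.2 (.inl ?_)
  change n • (0 : ℤ) < 1
  rw [smul_zero]
  exact one_pos

theorem exists_eq_low_of_mem_rad {x : G.mvAlg.carrier} (hx : x ∈ rad G.mvAlg.carrier) :
    ∃ g hg, x = low g hg := by
  rcases exists_eq_low_or_neg_low x with h | ⟨g, hg, rfl⟩
  · exact h
  · exact absurd hx (neg_notMem_rad (perfect_gamma_lexZ G) (low_mem_rad g hg))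

end AbLGroup

/-! ### `Δ` is an equivalence -/

namespace MVAlg

open MVAlgebra

variable {A B : MVAlg.{u}}

theorem Hom.map_ominus (f : Hom A B) (x y : A.carrier) :
    f.toFun (ominus x y) = ominus (f.toFun x) (f.toFun y) := by
  rw [ominus, f.map_neg, f.map_oplus, f.map_neg, ominus]

theorem Hom.map_nmul (f : Hom A B) (n : ℕ) (x : A.carrier) :
    f.toFun (nmul n x) = nmul n (f.toFun x) := by
  induction n with
  | zero => exact f.map_zero
  | succ n ih => rw [nmul, f.map_oplus, ih, nmul]

theorem Hom.map_mem_rad (f : Hom A B) {x : A.carrier} (hx : x ∈ rad A.carrier) :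
    f.toFun x ∈ rad B.carrier := fun n hn => by
  obtain ⟨z, hz⟩ := hx n hn
  exact ⟨f.toFun z, by rw [← f.map_neg, hz, f.map_oplus, f.map_nmul]⟩

/-- A bijective homomorphism of MV-algebras is an isomorphism. -/
noncomputable def isoOfBijective (f : Hom A B) (hf : Function.Bijective f.toFun) : A ≅ B where
  hom := f
  inv :=
    let e := Equiv.ofBijective f.toFun hf
    { toFun := e.symm
      map_oplus := fun x y => e.symm_apply_eq.2 <| by
        change oplus x y = f.toFun _
        rw [f.map_oplus]
        exact (congrArg₂ oplus (e.apply_symm_apply x) (e.apply_symm_apply y)).symm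
      map_zero := e.symm_apply_eq.2 f.map_zero.symm
      map_one := e.symm_apply_eq.2 f.map_one.symm
      map_neg := fun x => e.symm_apply_eq.2 <| by
        change neg x = f.toFun _
        rw [f.map_neg]
        exact (congrArg neg (e.apply_symm_apply x)).symm }
  hom_inv_id := Hom.ext (funext (Equiv.ofBijective f.toFun hf).symm_apply_apply)
  inv_hom_id := Hom.ext (funext (Equiv.ofBijective f.toFun hf).apply_symm_apply)

end MVAlg

/-! ### Full faithfulness of `Δ`. -/

namespace AbLGroup

open MVAlgebra

variable {G H : AbLGroup.{u}}

theorem map_low (f : Hom G H) (g : G.carrier) (hg : 0 ≤ g) :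
    ((lexZFunctor ⋙ Gamma).map f).toFun (low g hg) =
      low (f.toFun g) (f.map_zero.symm.le.trans (f.monotone hg)) := rfl

theorem hom_ext_of_nonneg {f f' : Hom G H} (h : ∀ g, 0 ≤ g → f.toFun g = f'.toFun g) :
    f = f' := by
  refine Hom.ext (funext fun x => ?_)
  rw [← posPart_sub_negPart x, f.map_sub, f'.map_sub, h _ (posPart_nonneg x),
    h _ (negPart_nonneg x)]

/-- A map on the positive cone that preserves sums and truncated differences extends to an ℓ-group
homomorphism. -/
theorem exists_hom_of_nonneg (p : G.carrier → H.carrier)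
    (hadd : ∀ a b, 0 ≤ a → 0 ≤ b → p (a + b) = p a + p b)
    (hsub : ∀ a b, 0 ≤ a → 0 ≤ b → p ((a - b) ⊔ 0) = (p a - p b) ⊔ 0) :
    ∃ f : Hom G H, ∀ a, 0 ≤ a → f.toFun a = p a := by
  -- The value does not depend on how `x` is written as a difference of positive elements.
  have key : ∀ a b x, 0 ≤ a → 0 ≤ b → x = a - b → p x⁺ - p x⁻ = p a - p b := by
    rintro a b x ha hb h
    have h' : x⁺ + b = a + x⁻ := by
      rw [← sub_eq_sub_iff_add_eq_add, posPart_sub_negPart, h]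
    rw [sub_eq_sub_iff_add_eq_add, ← hadd _ _ (posPart_nonneg x) hb,
      ← hadd _ _ ha (negPart_nonneg x), h']
  let f : G.carrier →+ H.carrier := AddMonoidHom.mk' (fun x => p x⁺ - p x⁻) fun x y => by
    rw [key (x⁺ + y⁺) (x⁻ + y⁻) (x + y) (add_nonneg (posPart_nonneg x) (posPart_nonneg y))
      (add_nonneg (negPart_nonneg x) (negPart_nonneg y))
      (by rw [add_sub_add_comm, posPart_sub_negPart, posPart_sub_negPart]),
      hadd _ _ (posPart_nonneg x) (posPart_nonneg y),
      hadd _ _ (negPart_nonneg x) (negPart_nonneg y), add_sub_add_comm]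
  have hp0 : p 0 = 0 := by simpa using hadd 0 0 le_rfl le_rfl
  have hf : ∀ a, 0 ≤ a → f a = p a := fun a ha =>
    (key a 0 a ha le_rfl (sub_zero a).symm).trans (by rw [hp0, sub_zero])
  have hpos : ∀ x, f (x ⊔ 0) = f x ⊔ 0 := fun x => by
    have := hsub x⁺ x⁻ (posPart_nonneg x) (negPart_nonneg x)
    rw [posPart_sub_negPart] at this
    rw [hf _ le_sup_right, this]
    rfl
  refine ⟨Hom.ofSup f fun x y => ?_, hf⟩
  -- Translation reduces arbitrary joins to joins with `0`.
  have hxy : ∀ {K : AbLGroup.{u}} (a b : K.carrier), a ⊔ b = (a - b) ⊔ 0 + b := fun a b => by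
    rw [sup_add, sub_add_cancel, zero_add]
  rw [hxy, map_add, hpos, map_sub, ← hxy]

theorem exists_map_eq (h : MVAlg.Hom G.mvAlg H.mvAlg) :
    ∃ f : Hom G H, (lexZFunctor ⋙ Gamma).map f = h := by
  have hex : ∀ g : G.carrier, ∃ k : H.carrier, ∀ hg : 0 ≤ g, ∃ hk : 0 ≤ k,
      h.toFun (low g hg) = low k hk := fun g => by
    by_cases hg : 0 ≤ g
    · obtain ⟨k, hk, e⟩ := exists_eq_low_of_mem_rad (h.map_mem_rad (low_mem_rad g hg))
      -- Homomorphisms preserve infinitesimals, which yields `k`; off the positive cone the value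
      -- `0` below is arbitrary.
      exact ⟨k, fun _ => ⟨hk, e⟩⟩
    · exact ⟨0, fun hg' => absurd hg' hg⟩
  choose p hp using hex
  have hp0 : ∀ {g} (_ : 0 ≤ g), 0 ≤ p g := fun hg => (hp _ hg).1
  have hpl : ∀ {g} (hg : 0 ≤ g), h.toFun (low g hg) = low (p g) (hp0 hg) := fun hg => (hp _ hg).2
  obtain ⟨f, hf⟩ := exists_hom_of_nonneg p
    (fun a b ha hb => low_injective (hg := hp0 (add_nonneg ha hb))
      (hh := add_nonneg (hp0 ha) (hp0 hb)) <| by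
        rw [← hpl (add_nonneg ha hb), ← low_oplus_low _ _ ha hb, h.map_oplus, hpl, hpl, low_oplus_low])
    (fun a b ha hb => low_injective (hg := hp0 le_sup_right) (hh := le_sup_right) <| by
        rw [← hpl le_sup_right, ← low_ominus_low _ _ ha hb, h.map_ominus, hpl, hpl, low_ominus_low])
  have hlow : ∀ g hg, ((lexZFunctor ⋙ Gamma).map f).toFun (low g hg) = h.toFun (low g hg) :=
    fun g hg => by rw [map_low, hpl, low_congr (hf g hg)]
  refine ⟨f, MVAlg.Hom.ext (funext fun x => ?_)⟩
  rcases exists_eq_low_or_neg_low x with ⟨g, hg, rfl⟩ | ⟨g, hg, rfl⟩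
  · exact hlow g hg
  · rw [MVAlg.Hom.map_neg, MVAlg.Hom.map_neg, hlow]

end AbLGroup

/-! ### Essential surjectivity of `Δ`. -/

namespace MVAlgebra

open AbLGroup

variable {A : Type u} [MVAlgebra A]

open Classical in
/-- The comparison map from a perfect MV-algebra `A` to `Δ(G)`, where `G` is the ℓ-group of
differences of infinitesimals. -/
noncomputable def toDelta (hA : IsPerfect A) (x : A) : (radGroup A).mvAlg.carrier :=
  if hx : x ∈ rad A then low (ofRad x hx) (ofRad_nonneg hx)
  else
    have hx' := (mem_rad_or_neg_mem_rad hA x).resolve_left hx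
    neg (low (ofRad (neg x) hx') (ofRad_nonneg hx'))

theorem toDelta_of_mem (hA : IsPerfect A) {x : A} (hx : x ∈ rad A) :
    toDelta hA x = low (ofRad x hx) (ofRad_nonneg hx) := dif_pos hx

theorem toDelta_neg_of_mem (hA : IsPerfect A) {x : A} (hx : x ∈ rad A) :
    toDelta hA (neg x) = neg (low (ofRad x hx) (ofRad_nonneg hx)) := by
  rw [toDelta, dif_neg (neg_notMem_rad hA hx)]
  simp only [neg_neg]

theorem toDelta_zero (hA : IsPerfect A) : toDelta hA zero = zero := by
  rw [toDelta_of_mem hA zero_mem_rad, ← low_zero]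
  exact low_congr ofRad_zero _ _

theorem toDelta_neg (hA : IsPerfect A) (x : A) : toDelta hA (neg x) = neg (toDelta hA x) := by
  rcases mem_rad_or_neg_mem_rad hA x with hx | hx
  · rw [toDelta_neg_of_mem hA hx, toDelta_of_mem hA hx]
  · obtain ⟨y, rfl⟩ : ∃ y, x = neg y := ⟨neg x, (neg_neg x).symm⟩
    rw [neg_neg] at hx ⊢
    rw [toDelta_neg_of_mem hA hx, toDelta_of_mem hA hx, neg_neg]

theorem toDelta_one (hA : IsPerfect A) : toDelta hA one = one := by
  rw [← neg_zero, toDelta_neg, toDelta_zero, neg_zero]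

/-- Since `¬x ⊕ y = ¬(x ⊖ y)`, the mixed case reduces to truncated differences of infinitesimals. -/
theorem toDelta_neg_oplus (hA : IsPerfect A) {x y : A} (hx : x ∈ rad A) (hy : y ∈ rad A) :
    toDelta hA (oplus (neg x) y) = oplus (toDelta hA (neg x)) (toDelta hA y) := by
  apply neg_injective
  rw [toDelta_neg_of_mem hA hx, toDelta_of_mem hA hy, ← toDelta_neg]
  change toDelta hA (ominus x y) = ominus _ _
  rw [toDelta_of_mem hA (ominus_mem_rad hx y), low_ominus_low]
  exact low_congr (ofRad_ominus hx hy) _ _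

theorem toDelta_oplus (hA : IsPerfect A) (x y : A) :
    toDelta hA (oplus x y) = oplus (toDelta hA x) (toDelta hA y) := by
  rcases mem_rad_or_neg_mem_rad hA x with hx | hx
  · rcases mem_rad_or_neg_mem_rad hA y with hy | hy
    · rw [toDelta_of_mem hA (oplus_mem_rad hx hy), toDelta_of_mem hA hx, toDelta_of_mem hA hy,
        low_oplus_low]
      exact low_congr (ofRad_oplus hx hy) _ _
    · rw [oplus_comm, oplus_comm (toDelta hA x), ← neg_neg y]
      exact toDelta_neg_oplus hA hy hx
  · rw [← neg_neg x]
    rcases mem_rad_or_neg_mem_rad hA y with hy | hy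
    · exact toDelta_neg_oplus hA hx hy
    -- Both sides equal `1`; in `A` this says that `x ≤ ¬y` for infinitesimals.
    · rw [← neg_neg y, toDelta_neg_of_mem hA hx, toDelta_neg_of_mem hA hy, neg_low_oplus_neg_low,
        le_iff_neg_oplus.1, toDelta_one]
      exact le_neg_of_mem_rad hx hy

theorem toDelta_injective (hA : IsPerfect A) : Function.Injective (toDelta hA) := by
  -- The map reflects infinitesimality, so elements of the two halves are never identified.
  have mem : ∀ {x}, toDelta hA x ∈ rad (radGroup A).mvAlg.carrier → x ∈ rad A := fun {x} h => by
    refine (mem_rad_or_neg_mem_rad hA x).resolve_right fun hx => ?_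
    have hn := toDelta_neg_of_mem hA hx
    rw [neg_neg] at hn
    rw [hn] at h
    exact neg_notMem_rad (perfect_gamma_lexZ _) (low_mem_rad _ _) h
  have inj : ∀ {x y}, x ∈ rad A → toDelta hA x = toDelta hA y → x = y := fun {x y} hx h => by
    have hx' := toDelta_of_mem hA hx
    have hy : y ∈ rad A := mem (by
      rw [← h, hx']
      exact low_mem_rad _ _)
    rw [hx', toDelta_of_mem hA hy] at h
    exact ofRad_injective (low_injective h)
  intro x y h
  rcases mem_rad_or_neg_mem_rad hA x with hx | hx
  · exact inj hx h
  · exact neg_injective (inj hx (by rw [toDelta_neg, toDelta_neg, h]))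

theorem toDelta_surjective (hA : IsPerfect A) : Function.Surjective (toDelta hA) := by
  have surj : ∀ g hg, ∃ x, toDelta hA x = low g hg := fun g hg => by
    obtain ⟨x, hx, rfl⟩ := exists_ofRad_of_nonneg hg
    exact ⟨x, toDelta_of_mem hA hx⟩
  intro y
  rcases exists_eq_low_or_neg_low y with ⟨g, hg, rfl⟩ | ⟨g, hg, rfl⟩
  · exact surj g hg
  · obtain ⟨x, hx⟩ := surj g hg
    exact ⟨neg x, by rw [toDelta_neg, hx]⟩

end MVAlgebra

namespace PerfectMVAlg

open MVAlgebra

/-- The comparison homomorphism from a perfect MV-algebra `A` to `Δ(G)`. -/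
noncomputable def toDeltaHom (A : PerfectMVAlg.{u}) :
    MVAlg.Hom A.obj (radGroup A.obj.carrier).mvAlg where
  toFun := toDelta A.property
  map_oplus := toDelta_oplus A.property
  map_zero := toDelta_zero A.property
  map_one := toDelta_one A.property
  map_neg := toDelta_neg A.property

/-- Every perfect MV-algebra is isomorphic to `Δ(G)` for the ℓ-group `G` of differences of its
infinitesimals. -/
noncomputable def isoDelta (A : PerfectMVAlg.{u}) : A ≅ Delta.obj (radGroup A.obj.carrier) :=
  MVAlg.perfect.isoMk (Y := Delta.obj (radGroup A.obj.carrier))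
    (MVAlg.isoOfBijective (toDeltaHom A)
      ⟨toDelta_injective A.property, toDelta_surjective A.property⟩)

end PerfectMVAlg

theorem Delta_isEquivalence : Delta.{u}.IsEquivalence where
  faithful := ⟨fun {G H f f'} h => AbLGroup.hom_ext_of_nonneg fun g hg => by
    have h' : (lexZFunctor ⋙ Gamma).map f = (lexZFunctor ⋙ Gamma).map f' :=
      congrArg (fun k => k.hom) h
    have e := congrArg (fun k : MVAlg.Hom G.mvAlg H.mvAlg => k.toFun (AbLGroup.low g hg)) h'
    rw [AbLGroup.map_low, AbLGroup.map_low] at e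
    exact AbLGroup.low_injective e⟩
  full := ⟨fun {_ _} h => by
    obtain ⟨f, hf⟩ := AbLGroup.exists_map_eq h.hom
    exact ⟨f, ObjectProperty.hom_ext _ hf⟩⟩
  essSurj := ⟨fun A => ⟨MVAlgebra.radGroup A.obj.carrier, ⟨(PerfectMVAlg.isoDelta A).symm⟩⟩⟩

theorem mainTheorem1 :
    rho.{u}.IsEquivalence ∧ Delta.{u}.IsEquivalence ∧ (rho.{u} ⋙ Delta.{u}).IsEquivalence := by
  have := rho_isEquivalence.{u}
  have := Delta_isEquivalence.{u}
  exact ⟨inferInstance, inferInstance, inferInstance⟩
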